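/- For $\tau>0$ let $G(z;\tau)$ be Barnes' double gamma function, $$G(z;\tau)=\frac{1}{\tau\,\Gamma(z)}\exp\Big[\tilde a(\tau)\frac z\tau+\tilde b(\tau)\frac{z^2}{2\tau^2}\Big]\prod_{k=1}^{\infty}\frac{\Gamma(k\tau)}{\Gamma(z+k\tau)}\exp\Big[z\,\psi(k\tau)+\frac{z^2}{2}\psi'(k\tau)\Big],$$ where $\psi=\Gamma'/\Gamma$, $\tilde a(\tau)=\frac\tau2\log(2\pi\tau)+\frac12\log\tau-\tau C(\tau)$, $\tilde b(\tau)=-\tau\log\tau-\tau^2D(\tau)$, and $$C(\tau)=\lim_{N\to\infty}\Big[\sum_{k=1}^{N-1}\psi(k\tau)+\tfrac12\psi(N\tau)-\tfrac1\tau\log\frac{\Gamma(N\tau)}{\sqrt{2\pi}}\Big],\qquad D(\tau)=\lim_{N\to\infty}\Big[\sum_{k=1}^{N-1}\psi'(k\tau)+\tfrac12\psi'(N\tau)-\tfrac1\tau\psi(N\tau)\Big].$$ For $0\le n\le p$, $0\le m\le q$, $a_i,b_i\in\mathbb C$, $\alpha_i,\beta_i>0$ and $z\in\mathbb C\setminus\{0\}$,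 the Fox–Barnes $I$-function (with compensation parameter $\varepsilon=0$) and the Fox $H$-function defined by a contour $\mathcal C$ are $$I^{m,n}_{p,q}\Big[z;\tau\,\Big|\,{(a_i,\alpha_i)_{1,p}\atop(b_i,\beta_i)_{1,q}}\Big]=\frac1{2\pi i}\int_{\mathcal C}\frac{\prod_{i=1}^mG(b_i+\beta_is;\tau)\prod_{i=1}^nG(1+\tau-a_i-\alpha_is;\tau)}{\prod_{i=m+1}^qG(1+\tau-b_i-\beta_is;\tau)\prod_{i=n+1}^pG(a_i+\alpha_is;\tau)}\,z^{-s}\,ds,$$ $$H^{m,n}_{p,q}\Big[z\,\Big|\,{(a_i,\alpha_i)_{1,p}\atop(b_i,\beta_i)_{1,q}}\Big]=\frac1{2\pi i}\int_{\mathcal C}\frac{\prod_{i=1}^m\Gamma(b_i+\beta_is)\prod_{i=1}^n\Gamma(1-a_i-\alpha_is)}{\prod_{i=m+1}^q\Gamma(1-b_i-\beta_is)\prod_{i=n+1}^p\Gamma(a_i+\alpha_is)}\,z^{-s}\,ds,$$ with the principal branch of $z^{-s}$. Here $\mathcal C$ is a piecewise $C^1$ contour of one of the following shapes: a vertical contour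 $\mathcal C_{ic\infty}$ from $c-i\infty$ to $c+i\infty$; a left loop $\mathcal C_{-\infty}$ or a right loop $\mathcal C_{+\infty}$ in a horizontal strip; or a contour $\mathcal C_{(\theta_-,\theta_+)}$ that begins with a half-line of direction $\theta_-\in(-\pi,0)$ and ends with one of direction $\theta_+\in(0,\pi)$. It is called admissible for $I$ if it separates the points $-\frac1{\alpha_j}(a_j+k\tau+l)$ ($n<j\le p$, $k,l\ge0$) from the points $\frac1{\beta_i}(-b_i+k\tau+l)$ ($m<i\le q$, $k,l\ge1$), and admissible for $H$ if it separates the points $-\frac1{\beta_i}(b_i+k)$ ($1\le i\le m$, $k\ge0$) from the points $\frac1{\alpha_i}(1-a_i+k)$ ($1\le i\le n$, $k\ge0$). Separating means: $\mathcal C_{ic\infty}$ and $\mathcal C_{(\theta_-,\theta_+)}$ have the first family on the left and the second on the right; $\mathcal C_{-\infty}$ (respectively $\mathcal C_{+\infty}$) encircles once, in the positive direction, every point of the first (respectively second) family and none of the other. **Proposition.** Let $\tau>0$, $p=q=m+n$, $\alpha_i,\beta_i>0$, $\alpha_i=\beta_{m+i}$ for $1\le i\le n$ and $\beta_i=\alpha_{n+i}$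 for $1\le i\le m$. Suppose that there are $1\le m_0\le m$ and $1\le n_0\le n$ with $$a_i=\begin{cases}b_{m+i}-\tau,&1\le i\le n_0,\\ b_{m+i}+\tau,&n_0<i\le n,\end{cases}\qquad b_i=\begin{cases}a_{n+i}+\tau,&1\le i\le m_0,\\ a_{n+i}-\tau,&m_0<i\le m.\end{cases}$$ Put $p_0=n_0+m-m_0$, $q_0=m_0+n-n_0$, $\mathcal N_0=2(m_0+n_0)-(p_0+q_0)$, $\nu_0=\frac{q_0-p_0}2$, $$(\bar a_k,\bar\alpha_k)=\begin{cases}(a_k,\alpha_k),&1\le k\le n_0,\\(a_{n-n_0+m_0+k}-\tau,\ \alpha_{n-n_0+m_0+k}),&n_0<k\le p_0,\end{cases}$$ $$(\bar b_k,\bar\beta_k)=\begin{cases}(b_k-\tau,\beta_k),&1\le k\le m_0,\\(b_{m-m_0+n_0+k},\ \beta_{m-m_0+n_0+k}),&m_0<k\le q_0,\end{cases}$$ $\bar\Delta^*=\sum_{k=1}^{q_0}\bar\beta_k-\sum_{k=1}^{p_0}\bar\alpha_k$ and $\bar\delta^*=\sum_{k=1}^{q_0}\bar b_k-\sum_{k=1}^{p_0}\bar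 a_k$. Let $z\ne0$ and let $\mathcal C$ be admissible for $I^{m,n}_{p,q}$ with the parameters $(a_i,\alpha_i),(b_i,\beta_i)$. Then $\mathcal C$ is admissible for $H^{m_0,n_0}_{p_0,q_0}$ with the parameters $(\bar a_k,\bar\alpha_k),(\bar b_k,\bar\beta_k)$; the integral over $\mathcal C$ defining the left-hand side below converges absolutely if and only if the one defining the right-hand side does; and in this case, with both functions defined by $\mathcal C$, $$I^{m,n}_{p,q}\Big[z;\tau\,\Big|\,{(a_i,\alpha_i)_{1,p}\atop(b_i,\beta_i)_{1,q}}\Big]=(2\pi)^{(\tau-1)\mathcal N_0/2}\;\tau^{\nu_0-\bar\delta^*}\;H^{m_0,n_0}_{p_0,q_0}\Big[\tau^{\bar\Delta^*}z\,\Big|\,{(\bar a_k,\bar\alpha_k)_{1,p_0}\atop(\bar b_k,\bar\beta_k)_{1,q_0}}\Big].$$ -/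

import Mathlib

namespace FoxBarnes

open Filter Topology

noncomputable section

/-! ### The double gamma function -/

/-- The digamma function `ψ` on the real line. -/
def psi (x : ℝ) : ℝ := logDeriv Real.Gamma x

/-- The derivative `ψ'` of the digamma function. -/
def psi' (x : ℝ) : ℝ := deriv psi x

/-- `C(τ) = lim [∑_{k=1}^{N-1} ψ(kτ) + ψ(Nτ)/2 - (1/τ) log (Γ(Nτ)/√(2π))]`. -/
def constC (τ : ℝ) : ℝ :=
  limUnder atTop fun N : ℕ =>
    (∑ k ∈ Finset.Ico 1 N, psi (k * τ)) + psi (N * τ) / 2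
      - (1 / τ) * Real.log (Real.Gamma (N * τ) / Real.sqrt (2 * Real.pi))

/-- `D(τ) = lim [∑_{k=1}^{N-1} ψ'(kτ) + ψ'(Nτ)/2 - (1/τ) ψ(Nτ)]`. -/
def constD (τ : ℝ) : ℝ :=
  limUnder atTop fun N : ℕ =>
    (∑ k ∈ Finset.Ico 1 N, psi' (k * τ)) + psi' (N * τ) / 2 - (1 / τ) * psi (N * τ)

/-- `ã(τ) = (τ/2) log (2πτ) + (1/2) log τ - τ C(τ)`. -/
def constA (τ : ℝ) : ℝ :=
  τ / 2 * Real.log (2 * Real.pi * τ) + 1 / 2 * Real.log τ - τ * constC τ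

/-- `b̃(τ) = - τ log τ - τ² D(τ)`. -/
def constB (τ : ℝ) : ℝ := - (τ * Real.log τ) - τ ^ 2 * constD τ

/-- Barnes' double gamma function
`G(z;τ) = (τ Γ(z))⁻¹ exp[ã z/τ + b̃ z²/(2τ²)]
  ∏_{k ≥ 1} (Γ(kτ)/Γ(z+kτ)) exp[z ψ(kτ) + (z²/2) ψ'(kτ)]`.
Mathlib's `Gamma` is `0` at its poles and `x / 0 = 0`, so the factors `1/Γ` have their correct
value `0` at these points. -/
def doubleGamma (z : ℂ) (τ : ℝ) : ℂ :=
  1 / ((τ : ℂ) * Complex.Gamma z)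
    * Complex.exp ((constA τ : ℂ) * z / τ + (constB τ : ℂ) * z ^ 2 / (2 * (τ : ℂ) ^ 2))
    * ∏' k : ℕ,
        (Complex.Gamma (((k + 1 : ℕ) : ℂ) * τ) / Complex.Gamma (z + ((k + 1 : ℕ) : ℂ) * τ)
          * Complex.exp (z * (psi ((k + 1 : ℕ) * τ) : ℂ)
              + z ^ 2 / 2 * (psi' ((k + 1 : ℕ) * τ) : ℂ)))

/-! ### Contours -/

/-- The shapes of the contours: the vertical contour `𝓒_{ic∞}`, the left loop `𝓒_{-∞}` and the
right loop `𝓒_{+∞}` in a horizontal strip whose ends have ordinates `φ₁` and `φ₂`, and the general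
contour `𝓒_{(θ₁,θ₂)}`. -/
inductive ContourType : Type
  | vertical (c : ℝ)
  | leftLoop (φ₁ φ₂ : ℝ)
  | rightLoop (φ₁ φ₂ : ℝ)
  | oblique (θ₁ θ₂ : ℝ)

/-- `γ` is continuous, and `C¹` up to the end points on the pieces into which finitely many
parameter values cut the line. -/
def IsPiecewiseC1 (γ : ℝ → ℂ) : Prop :=
  Continuous γ ∧ ∃ S : Finset ℝ, ∀ u v : ℝ, u < v → (∀ t ∈ S, t ∉ Set.Ioo u v) →
    ContDiffOn ℝ 1 γ (Set.Icc u v)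

/-- `γ` starts with the half-line of direction `exp(i θ₁)` on the line through `P₁` (traversed
from infinity) and ends with the half-line of direction `exp(i θ₂)` on the line through `P₂`. -/
def HasRayEnds (γ : ℝ → ℂ) (P₁ : ℂ) (θ₁ : ℝ) (P₂ : ℂ) (θ₂ : ℝ) : Prop :=
  ∃ T : ℝ, 0 < T ∧
    (∀ t : ℝ, t ≤ -T → γ t = P₁ + ((-t : ℝ) : ℂ) * Complex.exp (θ₁ * Complex.I)) ∧
    (∀ t : ℝ, T ≤ t → γ t = P₂ + (t : ℂ) * Complex.exp (θ₂ * Complex.I))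

/-- How a contour of each shape begins and ends. -/
def HasShape (γ : ℝ → ℂ) : ContourType → Prop
  | .vertical c => ∃ P₁ P₂ : ℂ, P₁.re = c ∧ P₂.re = c ∧
      HasRayEnds γ P₁ (-(Real.pi / 2)) P₂ (Real.pi / 2)
  | .leftLoop φ₁ φ₂ => φ₁ < 0 ∧ 0 < φ₂ ∧ ∃ P₁ P₂ : ℂ, P₁.im = φ₁ ∧ P₂.im = φ₂ ∧
      HasRayEnds γ P₁ (-Real.pi) P₂ Real.pi
  | .rightLoop φ₁ φ₂ => φ₁ < 0 ∧ 0 < φ₂ ∧ ∃ P₁ P₂ : ℂ, P₁.im = φ₂ ∧ P₂.im = φ₁ ∧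
      HasRayEnds γ P₁ 0 P₂ 0
  | .oblique θ₁ θ₂ => -Real.pi < θ₁ ∧ θ₁ < 0 ∧ 0 < θ₂ ∧ θ₂ < Real.pi ∧
      ∃ P₁ P₂ : ℂ, HasRayEnds γ P₁ θ₁ P₂ θ₂

/-- The point `w` is not on `γ`, and the continuous argument of `γ t - w` increases in total by
`δ` along `γ`. -/
def HasArgChange (γ : ℝ → ℂ) (w : ℂ) (δ : ℝ) : Prop :=
  (∀ t, γ t ≠ w) ∧ ∃ θ : ℝ → ℝ, Continuous θ ∧
    (∀ t, γ t - w = (‖γ t - w‖ : ℂ) * Complex.exp (θ t * Complex.I)) ∧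
    ∃ l : ℝ, Tendsto θ atBot (𝓝 l) ∧ Tendsto θ atTop (𝓝 (l + δ))

/-- `γ` is a contour of the given shape that separates the points of `L` from those of `R`:
for `𝓒_{ic∞}` and `𝓒_{(θ₁,θ₂)}` the points of `L` lie to the left and those of `R` to the right of
`γ`; the left loop encircles once in the positive direction the points of `L` and none of `R`; the
right loop encircles once in the positive direction the points of `R` and none of `L`. -/
def IsSeparatingContour (κ : ContourType) (γ : ℝ → ℂ) (L R : Set ℂ) : Prop :=
  IsPiecewiseC1 γ ∧ HasShape γ κ ∧
    match κ with
    | .vertical _ =>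
        (∀ w ∈ L, HasArgChange γ w Real.pi) ∧ (∀ w ∈ R, HasArgChange γ w (-Real.pi))
    | .leftLoop _ _ =>
        (∀ w ∈ L, HasArgChange γ w (2 * Real.pi)) ∧ (∀ w ∈ R, HasArgChange γ w 0)
    | .rightLoop _ _ =>
        (∀ w ∈ L, HasArgChange γ w 0) ∧ (∀ w ∈ R, HasArgChange γ w (2 * Real.pi))
    | .oblique θ₁ θ₂ =>
        (∀ w ∈ L, HasArgChange γ w (θ₂ - θ₁)) ∧
        (∀ w ∈ R, HasArgChange γ w (θ₂ - θ₁ - 2 * Real.pi))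

/-- The integral of `f` along `γ` converges (absolutely). -/
def ContourIntegrable (f : ℂ → ℂ) (γ : ℝ → ℂ) : Prop :=
  MeasureTheory.Integrable fun t : ℝ => f (γ t) * deriv γ t

/-- The integral of `f` along `γ`. -/
def contourIntegral (f : ℂ → ℂ) (γ : ℝ → ℂ) : ℂ := ∫ t : ℝ, f (γ t) * deriv γ t

/-! ### The Fox-Barnes `I`-function and the Fox `H`-function

Parameters are indexed from `1`: only `a i`, `α i` with `1 ≤ i ≤ p` and `b i`, `β i` with
`1 ≤ i ≤ q` are used. -/

/-- The quotient of products of double gamma functions in the `I`-function. -/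
def kernelI (m n p q : ℕ) (a : ℕ → ℂ) (α : ℕ → ℝ) (b : ℕ → ℂ) (β : ℕ → ℝ) (τ : ℝ) (s : ℂ) : ℂ :=
  ((∏ i ∈ Finset.Icc 1 m, doubleGamma (b i + β i * s) τ)
      * ∏ i ∈ Finset.Icc 1 n, doubleGamma (1 + τ - a i - α i * s) τ)
    / ((∏ i ∈ Finset.Icc (m + 1) q, doubleGamma (1 + τ - b i - β i * s) τ)
      * ∏ i ∈ Finset.Icc (n + 1) p, doubleGamma (a i + α i * s) τ)

/-- The integrand of the `I`-function. -/
def integrandI (m n p q : ℕ) (a : ℕ → ℂ) (α : ℕ → ℝ) (b : ℕ → ℂ) (β : ℕ → ℝ) (τ : ℝ) (ε z : ℂ)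
    (s : ℂ) : ℂ :=
  kernelI m n p q a α b β τ s * Complex.exp (Real.pi * ε * s ^ 2 / τ) * z ^ (-s)

/-- Poles coming from the zeros of `G(a_j + α_j s; τ)`, `n < j ≤ p`. -/
def leftPolesI (n p : ℕ) (a : ℕ → ℂ) (α : ℕ → ℝ) (τ : ℝ) : Set ℂ :=
  {s | ∃ j ∈ Finset.Icc (n + 1) p, ∃ k l : ℕ, s = -(1 / (α j : ℂ)) * (a j + k * τ + l)}

/-- Poles coming from the zeros of `G(1 + τ - b_i - β_i s; τ)`, `m < i ≤ q`. -/
def rightPolesI (m q : ℕ) (b : ℕ → ℂ) (β : ℕ → ℝ) (τ : ℝ) : Set ℂ :=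
  {s | ∃ i ∈ Finset.Icc (m + 1) q, ∃ k l : ℕ, 1 ≤ k ∧ 1 ≤ l ∧
    s = (1 / (β i : ℂ)) * (-b i + k * τ + l)}

/-- `γ` is a contour of shape `κ` admissible in the definition of the `I`-function. -/
def IsContourI (m n p q : ℕ) (a : ℕ → ℂ) (α : ℕ → ℝ) (b : ℕ → ℂ) (β : ℕ → ℝ) (τ : ℝ)
    (κ : ContourType) (γ : ℝ → ℂ) : Prop :=
  IsSeparatingContour κ γ (leftPolesI n p a α τ) (rightPolesI m q b β τ)

/-- The Fox-Barnes `I`-function `I^{m,n}_{p,q}[z; τ, ε | (a_i,α_i)_{1,p}; (b_i,β_i)_{1,q}]` defined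
by the contour `γ`. -/
def foxBarnesI (m n p q : ℕ) (a : ℕ → ℂ) (α : ℕ → ℝ) (b : ℕ → ℂ) (β : ℕ → ℝ) (τ : ℝ) (ε z : ℂ)
    (γ : ℝ → ℂ) : ℂ :=
  1 / (2 * Real.pi * Complex.I) * contourIntegral (integrandI m n p q a α b β τ ε z) γ

/-- The quotient of products of gamma functions in the `H`-function. -/
def kernelH (m n p q : ℕ) (a : ℕ → ℂ) (α : ℕ → ℝ) (b : ℕ → ℂ) (β : ℕ → ℝ) (s : ℂ) : ℂ :=
  ((∏ i ∈ Finset.Icc 1 m, Complex.Gamma (b i + β i * s))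
      * ∏ i ∈ Finset.Icc 1 n, Complex.Gamma (1 - a i - α i * s))
    / ((∏ i ∈ Finset.Icc (m + 1) q, Complex.Gamma (1 - b i - β i * s))
      * ∏ i ∈ Finset.Icc (n + 1) p, Complex.Gamma (a i + α i * s))

/-- The integrand of the `H`-function. -/
def integrandH (m n p q : ℕ) (a : ℕ → ℂ) (α : ℕ → ℝ) (b : ℕ → ℂ) (β : ℕ → ℝ) (z : ℂ) (s : ℂ) : ℂ :=
  kernelH m n p q a α b β s * z ^ (-s)

/-- Poles of the factors `Γ(b_i + β_i s)`, `1 ≤ i ≤ m`. -/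
def leftPolesH (m : ℕ) (b : ℕ → ℂ) (β : ℕ → ℝ) : Set ℂ :=
  {s | ∃ i ∈ Finset.Icc 1 m, ∃ k : ℕ, s = -(1 / (β i : ℂ)) * (b i + k)}

/-- Poles of the factors `Γ(1 - a_i - α_i s)`, `1 ≤ i ≤ n`. -/
def rightPolesH (n : ℕ) (a : ℕ → ℂ) (α : ℕ → ℝ) : Set ℂ :=
  {s | ∃ i ∈ Finset.Icc 1 n, ∃ k : ℕ, s = (1 / (α i : ℂ)) * (1 - a i + k)}

/-- `γ` is a contour of shape `κ` admissible in the definition of the `H`-function. -/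
def IsContourH (m n : ℕ) (a : ℕ → ℂ) (α : ℕ → ℝ) (b : ℕ → ℂ) (β : ℕ → ℝ)
    (κ : ContourType) (γ : ℝ → ℂ) : Prop :=
  IsSeparatingContour κ γ (leftPolesH m b β) (rightPolesH n a α)

/-- The Fox `H`-function `H^{m,n}_{p,q}[z | (a_i,α_i)_{1,p}; (b_i,β_i)_{1,q}]` defined by the
contour `γ`. -/
def foxH (m n p q : ℕ) (a : ℕ → ℂ) (α : ℕ → ℝ) (b : ℕ → ℂ) (β : ℕ → ℝ) (z : ℂ) (γ : ℝ → ℂ) : ℂ :=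
  1 / (2 * Real.pi * Complex.I) * contourIntegral (integrandH m n p q a α b β z) γ

end

end FoxBarnes

/-!
The theorem rests on the functional equation of the double gamma function,
`G(z+τ) = (2π)^{(τ-1)/2} τ^{1/2-z} Γ(z) G(z)` (`inv_Gamma_mul_doubleGamma_add`). Under the
hypotheses on the parameters, every double gamma function in the numerator of the `I`-kernel can be
paired with one in the denominator whose argument differs from its own by `±τ`. Each quotient is
therefore `Γ` or `1/Γ` times an elementary factor. The gamma functions assemble into the `H`-kernel,
the elementary factors into the constant and the power `τ^{-Δs}` (`kernelI_eq_kernelH`). Dividing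
is legitimate on the contour: a point of the contour is not a pole of the `I`-kernel, and `G` has no
zeros but the points `-(kτ+l)` (`doubleGamma_ne_zero`). So the two integrands are proportional along
the contour. Admissibility passes from `I` to `H` because the poles for `H` are among those for `I`.

For the functional equation, Euler's limit formula for `Γ` gives
`Γ(x)/Γ(x+w) = exp(∑_j r(w/(x+j)) - w ψ(x) - (w²/2) ψ'(x))` with `r(u) = log(1+u) - u + u²/2`
(`Gamma_div_Gamma_add`, `psi_eq`, `psi'_eq`). Hence the factors of the infinite product are
`1 + O(x^{-3/2})` at `x = kτ`, and the product converges absolutely. In the truncated products, the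
shift by `τ` telescopes exactly, up to one further factor of the product, the `N`-th terms of the
sequences defining `C(τ)` and `D(τ)`, and a multiple of `ψ'(Nτ)`
(`inv_Gamma_mul_partialGammaProduct_add_eq`). Read at two positive points, where nothing vanishes,
this identity shows that the limits `C(τ)` and `D(τ)` exist, without any Euler-Maclaurin summation;
read at a general point in the limit `N → ∞`, it is the functional equation.
-/

namespace FoxBarnes

open Filter Topology

/-! ### Series for the digamma function and the local expansion of `log Γ` -/

/-- The remainder of `log (1 + u)` after its Taylor polynomial of degree two. -/
noncomputable def logRem (u : ℂ) : ℂ := Complex.log (1 + u) - u + u ^ 2 / 2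

lemma norm_logRem_le {u : ℂ} (hu : ‖u‖ ≤ 1 / 2) : ‖logRem u‖ ≤ ‖u‖ ^ 3 := by
  have h := Complex.norm_log_sub_logTaylor_le 2 (z := u) (by linarith)
  have e : Complex.log (1 + u) - Complex.logTaylor (2 + 1) u = logRem u := by
    simp [Complex.logTaylor, Finset.sum_range_succ, logRem]
    ring
  rw [e] at h
  refine h.trans ?_
  have h1 : (1 - ‖u‖)⁻¹ ≤ 2 := by
    rw [inv_le_comm₀ (by linarith) (by norm_num)]
    linarith
  have h2 : 0 ≤ ‖u‖ ^ 3 := by positivity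
  push_cast
  nlinarith

lemma summable_inv_add_pow {x : ℝ} (hx : 0 < x) {r : ℕ} (hr : 1 < r) :
    Summable fun j : ℕ => 1 / (x + j) ^ r := by
  refine ((Real.summable_one_div_nat_add_rpow x r).2 (by exact_mod_cast hr)).congr fun j => ?_
  rw [abs_of_pos (by positivity), Real.rpow_natCast, add_comm]

/-- The value of the digamma function at `x > 0`, as a series. -/
noncomputable def digammaSeries (x : ℝ) : ℝ :=
  -Real.eulerMascheroniConstant + ∑' j : ℕ, (1 / (1 + (j : ℝ)) - 1 / (x + j))

/-- The sum `∑_{j ≥ 0} (x + j)⁻²`. -/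
noncomputable def trigammaSeries (x : ℝ) : ℝ := ∑' j : ℕ, 1 / (x + j) ^ 2

lemma summable_digammaSeries {x : ℝ} (hx : 0 < x) :
    Summable fun j : ℕ => 1 / (1 + (j : ℝ)) - 1 / (x + j) := by
  -- both `1 + j` and `x + j` are at least `c + j`
  set c := min x 1
  have hc : 0 < c := lt_min hx one_pos
  refine Summable.of_norm_bounded ((summable_inv_add_pow hc one_lt_two).mul_left |x - 1|)
    fun j => ?_
  have e : 1 / (1 + (j : ℝ)) - 1 / (x + j) = (x - 1) * (1 / ((1 + j) * (x + j))) := by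
    field_simp
    ring
  rw [e, norm_mul, Real.norm_eq_abs, Real.norm_eq_abs, abs_of_pos (a := 1 / _) (by positivity)]
  gcongr
  rw [sq]
  gcongr
  · exact min_le_right _ _
  · exact min_le_left _ _

lemma tendsto_digammaSeries {x : ℝ} (hx : 0 < x) :
    Tendsto (fun n : ℕ => Real.log n - ∑ j ∈ Finset.range (n + 1), 1 / (x + j)) atTop
      (𝓝 (digammaSeries x)) := by
  have h1 := Real.tendsto_harmonic_sub_log
  have h2 := (summable_digammaSeries hx).hasSum.tendsto_sum_nat.comp (tendsto_add_atTop_nat 1)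
  have h3 := tendsto_one_div_add_atTop_nhds_zero_nat (𝕜 := ℝ)
  have h := (h1.neg.add h2).sub h3
  rw [sub_zero] at h
  refine h.congr fun n => ?_
  simp only [Function.comp, Finset.sum_sub_distrib, harmonic]
  have : ∑ x ∈ Finset.range (n + 1), 1 / (1 + (x : ℝ)) =
      ((∑ i ∈ Finset.range n, ((i + 1 : ℕ) : ℚ)⁻¹ : ℚ) : ℝ) + 1 / (n + 1) := by
    rw [Finset.sum_range_succ]
    push_cast
    simp [add_comm]
  rw [this]
  ring

lemma hasDerivAt_digammaSeries {x : ℝ} (hx : 0 < x) :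
    HasDerivAt digammaSeries (trigammaSeries x) x := by
  refine HasDerivAt.const_add _ ?_
  refine hasDerivAt_tsum_of_isPreconnected (t := Set.Ioi (x / 2)) (y₀ := x)
    (g := fun (j : ℕ) (y : ℝ) => 1 / (1 + (j : ℝ)) - 1 / (y + j))
    (g' := fun (j : ℕ) (y : ℝ) => 1 / (y + j) ^ 2)
    (summable_inv_add_pow (half_pos hx) one_lt_two) isOpen_Ioi isPreconnected_Ioi ?_ ?_
    (Set.mem_Ioi.2 (half_lt_self hx)) (summable_digammaSeries hx) (Set.mem_Ioi.2 (half_lt_self hx))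
  · intro j y hy
    have hy' : 0 < y := (half_pos hx).trans hy
    have h := (((hasDerivAt_id y).add_const (j : ℝ)).inv (by simp; positivity)).const_sub
      (1 / (1 + (j : ℝ)))
    simpa [one_div, neg_div] using h
  · intro j y hy
    have hy' : x / 2 < y := hy
    have : 0 < y := (half_pos hx).trans hy
    rw [Real.norm_of_nonneg (by positivity)]
    gcongr

lemma norm_div_add_le {x : ℝ} (hx : 0 < x) {w : ℂ} (hw : 2 * ‖w‖ ≤ x) (j : ℕ) :
    ‖w / (x + j)‖ ≤ 1 / 2 := by
  have : ‖(x + j : ℂ)‖ = x + j := by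
    rw [← Complex.ofReal_natCast, ← Complex.ofReal_add, Complex.norm_real,
      Real.norm_of_nonneg (by positivity)]
  rw [norm_div, this, div_le_iff₀ (by positivity)]
  have : (0 : ℝ) ≤ j := by positivity
  linarith

lemma norm_logRem_div_le {x : ℝ} (hx : 0 < x) {w : ℂ} (hw : 2 * ‖w‖ ≤ x) (j : ℕ) :
    ‖logRem (w / (x + j))‖ ≤ ‖w‖ ^ 3 * (1 / (x + j) ^ 3) := by
  refine (norm_logRem_le (norm_div_add_le hx hw j)).trans_eq ?_
  rw [norm_div, div_pow, ← Complex.ofReal_natCast, ← Complex.ofReal_add, Complex.norm_real,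
      Real.norm_of_nonneg (by positivity)]
  ring

lemma summable_logRem {x : ℝ} (hx : 0 < x) {w : ℂ} (hw : 2 * ‖w‖ ≤ x) :
    Summable fun j : ℕ => logRem (w / (x + j)) :=
  Summable.of_norm_bounded ((summable_inv_add_pow hx (by norm_num : 1 < 3)).mul_left (‖w‖ ^ 3))
    (norm_logRem_div_le hx hw)

lemma norm_tsum_logRem_le {x : ℝ} (hx : 0 < x) {w : ℂ} (hw : 2 * ‖w‖ ≤ x) :
    ‖∑' j : ℕ, logRem (w / (x + j))‖ ≤ ‖w‖ ^ 3 * ∑' j : ℕ, 1 / (x + j) ^ 3 := by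
  have h := (summable_inv_add_pow hx (by norm_num : 1 < 3)).mul_left (‖w‖ ^ 3)
  rw [← tsum_mul_left]
  exact tsum_of_norm_bounded h.hasSum (norm_logRem_div_le hx hw)

lemma add_ne_zero_of_norm_le {x : ℝ} (hx : 0 < x) {w : ℂ} (hw : 2 * ‖w‖ ≤ x) (j : ℕ) :
    (x + w + j : ℂ) ≠ 0 := by
  intro h
  have h1 := congrArg Complex.re h
  have h2 := Complex.abs_re_le_norm w
  have h3 := (abs_le.1 h2).1
  have h4 : (0 : ℝ) ≤ j := by positivity
  simp at h1
  linarith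

lemma GammaSeq_div_GammaSeq_add {x : ℝ} (hx : 0 < x) {w : ℂ} (hw : 2 * ‖w‖ ≤ x) {n : ℕ}
    (hn : n ≠ 0) :
    Complex.GammaSeq x n / Complex.GammaSeq (x + w) n =
      Complex.exp (∑ j ∈ Finset.range (n + 1), logRem (w / (x + j))
        - w * ((Real.log n - ∑ j ∈ Finset.range (n + 1), 1 / (x + j) : ℝ) : ℂ)
        - w ^ 2 / 2 * ((∑ j ∈ Finset.range (n + 1), 1 / (x + j) ^ 2 : ℝ) : ℂ)) := by
  have hn' : (n : ℂ) ≠ 0 := by exact_mod_cast hn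
  have hxj : ∀ j : ℕ, (x + j : ℂ) ≠ 0 := fun j => by
    have : (x + j : ℝ) ≠ 0 := by positivity
    exact_mod_cast this
  have e1 : Complex.GammaSeq x n / Complex.GammaSeq (x + w) n =
      (n : ℂ) ^ (-w) * ∏ j ∈ Finset.range (n + 1), (1 + w / (x + j)) := by
    have hf : ((n.factorial : ℕ) : ℂ) ≠ 0 := by exact_mod_cast n.factorial_ne_zero
    have h1 : ∏ j ∈ Finset.range (n + 1), ((x : ℂ) + j) ≠ 0 :=
      Finset.prod_ne_zero_iff.2 fun j _ => hxj j
    have h2 : ∏ j ∈ Finset.range (n + 1), ((x : ℂ) + w + j) ≠ 0 :=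
      Finset.prod_ne_zero_iff.2 fun j _ => add_ne_zero_of_norm_le hx hw j
    have h3 : ∏ j ∈ Finset.range (n + 1), (1 + w / (x + j)) =
        (∏ j ∈ Finset.range (n + 1), ((x : ℂ) + w + j)) /
          ∏ j ∈ Finset.range (n + 1), ((x : ℂ) + j) := by
      rw [← Finset.prod_div_distrib]
      refine Finset.prod_congr rfl fun j _ => ?_
      have := hxj j
      field_simp
      ring
    have h4 : (n : ℂ) ^ (x : ℂ) ≠ 0 := by simp [Complex.cpow_eq_zero_iff, hn']
    have h5 : (n : ℂ) ^ w ≠ 0 := by simp [Complex.cpow_eq_zero_iff, hn']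
    rw [h3, Complex.GammaSeq, Complex.GammaSeq, Complex.cpow_add _ _ hn', Complex.cpow_neg]
    field_simp
  have e2 : ∏ j ∈ Finset.range (n + 1), (1 + w / (x + j)) =
      Complex.exp (∑ j ∈ Finset.range (n + 1), Complex.log (1 + w / (x + j))) := by
    rw [Complex.exp_sum]
    refine Finset.prod_congr rfl fun j _ => (Complex.exp_log ?_).symm
    have h1 := add_ne_zero_of_norm_le hx hw j
    have h2 := hxj j
    have : 1 + w / (x + j) = (x + w + j) / (x + j) := by
      field_simp
      ring
    rw [this]
    exact div_ne_zero h1 h2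
  rw [e1, e2, Complex.cpow_def_of_ne_zero hn', ← Complex.exp_add]
  congr 1
  simp only [logRem, Finset.sum_add_distrib, Finset.sum_sub_distrib]
  push_cast [Complex.ofReal_log (Nat.cast_nonneg n)]
  rw [mul_sub, Finset.mul_sum, Finset.mul_sum, mul_neg, mul_comm w]
  have : ∑ i ∈ Finset.range (n + 1), (w / (x + i : ℂ)) ^ 2 / 2 =
      ∑ i ∈ Finset.range (n + 1), w ^ 2 / 2 * (1 / (x + i) ^ 2) :=
    Finset.sum_congr rfl fun j _ => by
      have := hxj j
      field_simp
  rw [this]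
  simp only [mul_one_div]
  ring

/-- The Weierstrass product of `Γ` near `x`, in exponential form; it is the limit of the
corresponding identity for Euler's finite products. -/
lemma Gamma_div_Gamma_add {x : ℝ} (hx : 0 < x) {w : ℂ} (hw : 2 * ‖w‖ ≤ x) :
    Complex.Gamma x / Complex.Gamma (x + w) =
      Complex.exp (∑' j : ℕ, logRem (w / (x + j)) - w * (digammaSeries x : ℂ)
        - w ^ 2 / 2 * (trigammaSeries x : ℂ)) := by
  have hG : Complex.Gamma (x + w) ≠ 0 := Complex.Gamma_ne_zero fun j h =>
    add_ne_zero_of_norm_le hx hw j (by rw [h]; ring)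
  refine tendsto_nhds_unique ((Complex.GammaSeq_tendsto_Gamma x).div
    (Complex.GammaSeq_tendsto_Gamma (x + w)) hG) ?_
  have h1 := (summable_logRem hx hw).hasSum.tendsto_sum_nat.comp (tendsto_add_atTop_nat 1)
  have h2 := (Complex.continuous_ofReal.tendsto _).comp (tendsto_digammaSeries hx)
  have h3 := (Complex.continuous_ofReal.tendsto _).comp
    ((summable_inv_add_pow hx one_lt_two).hasSum.tendsto_sum_nat.comp (tendsto_add_atTop_nat 1))
  refine (((h1.sub (h2.const_mul w)).sub (h3.const_mul (w ^ 2 / 2))).cexp).congr' ?_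
  filter_upwards [eventually_ne_atTop 0] with n hn
  exact (GammaSeq_div_GammaSeq_add hx hw hn).symm

/-- The remainder sum in `Gamma_div_Gamma_add` is `O(w³)`, so the derivative can be read off. -/
lemma hasDerivAt_Gamma_of_pos {x : ℝ} (hx : 0 < x) :
    HasDerivAt Complex.Gamma (Complex.Gamma x * digammaSeries x) x := by
  set S : ℂ → ℂ := fun w => ∑' j : ℕ, logRem (w / (x + j))
  have hnear : ∀ᶠ w : ℂ in 𝓝 0, 2 * ‖w‖ ≤ x := by
    have : Tendsto (fun w : ℂ => 2 * ‖w‖) (𝓝 0) (𝓝 0) := by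
      have : Continuous fun w : ℂ => 2 * ‖w‖ := by fun_prop
      simpa using this.tendsto 0
    exact (this.eventually_lt_const hx).mono fun w hw => hw.le
  have hS : HasDerivAt S 0 0 := by
    have hO : S =O[𝓝 0] fun w => ‖w - 0‖ ^ 3 := by
      refine Asymptotics.IsBigO.of_bound (∑' j : ℕ, 1 / (x + j) ^ 3) ?_
      filter_upwards [hnear] with w hw
      rw [sub_zero, norm_pow, norm_norm, mul_comm]
      exact norm_tsum_logRem_le hx hw
    simpa using (hO.hasFDerivAt (by norm_num)).hasDerivAt
  have hS0 : S 0 = 0 := by simp [S, logRem]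
  have h1 : HasDerivAt (fun w : ℂ => Complex.Gamma x * Complex.exp (-(S w - w * (digammaSeries x : ℂ)
      - w ^ 2 / 2 * (trigammaSeries x : ℂ)))) (Complex.Gamma x * digammaSeries x) 0 := by
    have h := ((((hS.sub ((hasDerivAt_id (0 : ℂ)).mul_const (digammaSeries x : ℂ))).sub
      ((((hasDerivAt_id (0 : ℂ)).pow 2).div_const 2).mul_const (trigammaSeries x : ℂ))).neg).cexp
      ).const_mul (Complex.Gamma x)
    simpa [hS0] using h
  have hGx : Complex.Gamma x ≠ 0 := Complex.Gamma_ne_zero_of_re_pos (by simpa)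
  have h2 : HasDerivAt (fun w : ℂ => Complex.Gamma (x + w)) (Complex.Gamma x * digammaSeries x) 0 := by
    refine h1.congr_of_eventuallyEq ?_
    filter_upwards [hnear] with w hw
    have h := Gamma_div_Gamma_add hx hw
    rw [Complex.exp_neg, ← h, inv_div, mul_div_cancel₀ _ hGx]
  have h3 := HasDerivAt.comp_sub_const (x : ℂ) (x : ℂ) (f := fun w : ℂ => Complex.Gamma (x + w))
    (f' := Complex.Gamma x * digammaSeries x) (by simpa using h2)
  simpa using h3

lemma psi_eq {x : ℝ} (hx : 0 < x) : psi x = digammaSeries x := by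
  have h := (hasDerivAt_Gamma_of_pos hx).real_of_complex
  have h' : HasDerivAt Real.Gamma (Real.Gamma x * digammaSeries x) x := by
    have e : (Complex.Gamma x * digammaSeries x).re = Real.Gamma x * digammaSeries x := by
      rw [Complex.Gamma_ofReal, ← Complex.ofReal_mul, Complex.ofReal_re]
    rw [e] at h
    refine h.congr_of_eventuallyEq (Eventually.of_forall fun y => ?_)
    simp [Complex.Gamma_ofReal]
  rw [psi, logDeriv_apply, h'.deriv, mul_div_cancel_left₀ _ (Real.Gamma_pos_of_pos hx).ne']

lemma psi'_eq {x : ℝ} (hx : 0 < x) : psi' x = trigammaSeries x := by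
  refine ((hasDerivAt_digammaSeries hx).congr_of_eventuallyEq ?_).deriv
  filter_upwards [lt_mem_nhds hx] with y hy using psi_eq hy

/-- Writing `r = s + 3/2` splits `(x + j)⁻ʳ` into a factor decaying in `x` and a summable factor in
`j`, uniformly for `x ≥ 1`. -/
lemma inv_add_pow_le {x : ℝ} (hx : 1 ≤ x) (j : ℕ) {r : ℕ} {s : ℝ} (hs : 0 ≤ s)
    (hr : s + 3 / 2 = r) :
    1 / (x + j) ^ r ≤ 1 / x ^ s * (1 / (1 + (j : ℝ)) ^ (3 / 2 : ℝ)) := by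
  have hj : (0 : ℝ) ≤ j := by positivity
  have e : (x + j) ^ r = (x + j) ^ s * (x + j) ^ (3 / 2 : ℝ) := by
    rw [← Real.rpow_add (by positivity), hr, Real.rpow_natCast]
  rw [e, one_div_mul_one_div]
  gcongr
  linarith

lemma exists_tsum_inv_add_pow_le {r : ℕ} {s : ℝ} (hs : 0 ≤ s) (hr : s + 3 / 2 = r) (hr1 : 1 < r) :
    ∃ K : ℝ, ∀ x : ℝ, 1 ≤ x → ∑' j : ℕ, 1 / (x + j) ^ r ≤ K * (1 / x ^ s) := by
  have hsum : Summable fun j : ℕ => 1 / (1 + (j : ℝ)) ^ (3 / 2 : ℝ) := by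
    refine ((Real.summable_one_div_nat_add_rpow 1 (3 / 2)).2 (by norm_num)).congr fun j => ?_
    rw [abs_of_pos (by positivity), add_comm]
  refine ⟨∑' j : ℕ, 1 / (1 + (j : ℝ)) ^ (3 / 2 : ℝ), fun x hx => ?_⟩
  rw [mul_comm, ← tsum_mul_left]
  exact (summable_inv_add_pow (by linarith) hr1).tsum_le_tsum
    (fun j => inv_add_pow_le hx j hs hr) (hsum.mul_left _)

lemma tendsto_psi'_atTop : Tendsto psi' atTop (𝓝 0) := by
  obtain ⟨K, hK⟩ := exists_tsum_inv_add_pow_le (r := 2) (s := 1 / 2) (by norm_num) (by norm_num)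
    (by norm_num)
  have h := ((tendsto_rpow_atTop (y := 1 / 2) (by norm_num)).inv_tendsto_atTop).const_mul K
  rw [mul_zero] at h
  refine squeeze_zero' ?_ ?_ h
  · filter_upwards [eventually_gt_atTop 0] with x hx
    rw [psi'_eq hx]
    exact tsum_nonneg fun j => by positivity
  · filter_upwards [eventually_ge_atTop 1] with x hx
    rw [psi'_eq (by linarith)]
    simpa [trigammaSeries] using hK x hx

/-! ### The infinite product of the double gamma function -/

/-- `Γ(x)/Γ(z+x) exp[z ψ(x) + (z²/2) ψ'(x)]`; the factors of the double gamma function are its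
values at `x = kτ`. -/
noncomputable def gammaFactor (z : ℂ) (x : ℝ) : ℂ :=
  Complex.Gamma x / Complex.Gamma (z + x) *
    Complex.exp (z * (psi x : ℂ) + z ^ 2 / 2 * (psi' x : ℂ))

lemma gammaFactor_eq_exp {x : ℝ} (hx : 0 < x) {w : ℂ} (hw : 2 * ‖w‖ ≤ x) :
    gammaFactor w x = Complex.exp (∑' j : ℕ, logRem (w / (x + j))) := by
  rw [gammaFactor, add_comm w, Gamma_div_Gamma_add hx hw, ← Complex.exp_add, psi_eq hx, psi'_eq hx]
  congr 1
  ring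

lemma gammaFactor_ne_zero {x : ℝ} (hx : 0 < x) {z : ℂ} (hz : ∀ l : ℕ, z + x ≠ -l) :
    gammaFactor z x ≠ 0 :=
  mul_ne_zero (div_ne_zero (Complex.Gamma_ne_zero_of_re_pos (by simpa))
    (Complex.Gamma_ne_zero hz)) (Complex.exp_ne_zero _)

lemma tendsto_one_div_rpow_atTop :
    Tendsto (fun x : ℝ => 1 / x ^ (3 / 2 : ℝ)) atTop (𝓝 0) :=
  (tendsto_rpow_atTop (by norm_num)).const_div_atTop 1

/-- Since `log (1 + u) - u + u²/2 = O(u³)`, the factors are `1 + O(x^{-3/2})`. -/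
lemma gammaFactor_sub_one_isBigO (z : ℂ) :
    (fun x : ℝ => gammaFactor z x - 1) =O[atTop] fun x : ℝ => 1 / x ^ (3 / 2 : ℝ) := by
  obtain ⟨K, hK⟩ := exists_tsum_inv_add_pow_le (r := 3) (s := 3 / 2) (by norm_num) (by norm_num)
    (by norm_num)
  set S : ℝ → ℂ := fun x => ∑' j : ℕ, logRem (z / (x + j))
  have hS : S =O[atTop] fun x : ℝ => 1 / x ^ (3 / 2 : ℝ) := by
    refine Asymptotics.IsBigO.of_bound (‖z‖ ^ 3 * K) ?_
    filter_upwards [eventually_ge_atTop 1, eventually_ge_atTop (2 * ‖z‖)] with x h1 h2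
    have hx : 0 < x := by linarith
    rw [Real.norm_of_nonneg (by positivity), mul_assoc]
    exact (norm_tsum_logRem_le hx h2).trans
      (mul_le_mul_of_nonneg_left (hK x h1) (by positivity))
  have h0 : Tendsto S atTop (𝓝 0) := hS.trans_tendsto tendsto_one_div_rpow_atTop
  have hE : (fun x => Complex.exp (S x) - 1) =O[atTop] S := by
    refine Asymptotics.IsBigO.of_bound 2 ?_
    filter_upwards [(h0.norm.eventually_lt_const (by simp : ‖(0 : ℂ)‖ < 1))] with x hx
    exact Complex.norm_exp_sub_one_le hx.le
  refine (hE.trans hS).congr' ?_ EventuallyEq.rfl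
  filter_upwards [eventually_gt_atTop 0, eventually_ge_atTop (2 * ‖z‖)] with x h1 h2
  rw [gammaFactor_eq_exp h1 h2]

lemma tendsto_gammaFactor (z : ℂ) : Tendsto (gammaFactor z) atTop (𝓝 1) := by
  have h : Tendsto (fun x : ℝ => gammaFactor z x - 1) atTop (𝓝 0) :=
    (gammaFactor_sub_one_isBigO z).trans_tendsto tendsto_one_div_rpow_atTop
  simpa using h.add_const 1

lemma tendsto_succ_mul_atTop {τ : ℝ} (hτ : 0 < τ) :
    Tendsto (fun k : ℕ => ((k + 1 : ℕ) : ℝ) * τ) atTop atTop :=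
  (tendsto_natCast_atTop_atTop.comp (tendsto_add_atTop_nat 1)).atTop_mul_const hτ

lemma summable_norm_gammaFactor_sub_one {τ : ℝ} (hτ : 0 < τ) (z : ℂ) :
    Summable fun k : ℕ => ‖gammaFactor z ((k + 1 : ℕ) * τ) - 1‖ := by
  have h := ((gammaFactor_sub_one_isBigO z).comp_tendsto (tendsto_succ_mul_atTop hτ)).norm_left
  refine summable_of_isBigO_nat ?_ h
  have hs : Summable fun k : ℕ => 1 / τ ^ (3 / 2 : ℝ) * (1 / (((k + 1 : ℕ) : ℝ)) ^ (3 / 2 : ℝ)) :=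
    ((summable_nat_add_iff 1).2 (Real.summable_one_div_nat_rpow.2 (by norm_num))).mul_left _
  refine hs.congr fun k => ?_
  simp only [Function.comp]
  rw [Real.mul_rpow (by positivity) hτ.le, one_div_mul_one_div, mul_comm]

lemma tendsto_prod_gammaFactor {τ : ℝ} (hτ : 0 < τ) (z : ℂ) :
    Tendsto (fun N : ℕ => ∏ k ∈ Finset.range N, gammaFactor z ((k + 1 : ℕ) * τ)) atTop
      (𝓝 (∏' k : ℕ, gammaFactor z ((k + 1 : ℕ) * τ))) := by
  have h := multipliable_one_add_of_summable (summable_norm_gammaFactor_sub_one hτ z)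
  simp only [add_sub_cancel] at h
  exact h.hasProd.tendsto_prod_nat

lemma tprod_gammaFactor_ne_zero {τ : ℝ} (hτ : 0 < τ) {z : ℂ}
    (hz : ∀ k l : ℕ, z ≠ -(k * τ + l)) : ∏' k : ℕ, gammaFactor z ((k + 1 : ℕ) * τ) ≠ 0 := by
  have h := tprod_one_add_ne_zero_of_summable (fun k => ?_) (summable_norm_gammaFactor_sub_one hτ z)
  · simpa only [add_sub_cancel] using h
  · rw [add_sub_cancel]
    refine gammaFactor_ne_zero (by positivity) fun l h => hz (k + 1) l ?_
    push_cast at h ⊢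
    linear_combination h

/-- The product `Γ(z)⁻¹ ∏_{k ≥ 1} Γ(kτ)/Γ(z+kτ) exp[z ψ(kτ) + (z²/2) ψ'(kτ)]`,
which is `G(z;τ)` without its elementary prefactor. -/
noncomputable def gammaProduct (τ : ℝ) (z : ℂ) : ℂ :=
  (Complex.Gamma z)⁻¹ * ∏' k : ℕ, gammaFactor z ((k + 1 : ℕ) * τ)

/-- The truncation of `gammaProduct` to its first `N` factors. -/
noncomputable def partialGammaProduct (τ : ℝ) (N : ℕ) (z : ℂ) : ℂ :=
  (Complex.Gamma z)⁻¹ * ∏ k ∈ Finset.range N, gammaFactor z ((k + 1 : ℕ) * τ)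

lemma tendsto_partialGammaProduct {τ : ℝ} (hτ : 0 < τ) (z : ℂ) :
    Tendsto (fun N => partialGammaProduct τ N z) atTop (𝓝 (gammaProduct τ z)) :=
  (tendsto_prod_gammaFactor hτ z).const_mul _

lemma gammaProduct_ne_zero {τ : ℝ} (hτ : 0 < τ) {z : ℂ} (hz : ∀ k l : ℕ, z ≠ -(k * τ + l)) :
    gammaProduct τ z ≠ 0 :=
  mul_ne_zero (inv_ne_zero (Complex.Gamma_ne_zero fun l => by simpa using hz 0 l))
    (tprod_gammaFactor_ne_zero hτ hz)

lemma doubleGamma_eq (z : ℂ) (τ : ℝ) :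
    doubleGamma z τ = (τ : ℂ)⁻¹ * Complex.exp ((constA τ : ℂ) * z / τ +
      (constB τ : ℂ) * z ^ 2 / (2 * (τ : ℂ) ^ 2)) * gammaProduct τ z := by
  have e : ∀ k : ℕ, gammaFactor z ((k + 1 : ℕ) * τ) =
      Complex.Gamma (((k + 1 : ℕ) : ℂ) * τ) / Complex.Gamma (z + ((k + 1 : ℕ) : ℂ) * τ)
          * Complex.exp (z * (psi ((k + 1 : ℕ) * τ) : ℂ)
              + z ^ 2 / 2 * (psi' ((k + 1 : ℕ) * τ) : ℂ)) := fun k => by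
    rw [gammaFactor, Complex.ofReal_mul, Complex.ofReal_natCast]
  simp only [doubleGamma, gammaProduct, e]
  rw [one_div, mul_inv]
  ring

lemma doubleGamma_ne_zero {τ : ℝ} (hτ : 0 < τ) {z : ℂ} (hz : ∀ k l : ℕ, z ≠ -(k * τ + l)) :
    doubleGamma z τ ≠ 0 := by
  rw [doubleGamma_eq]
  have : (τ : ℂ) ≠ 0 := by exact_mod_cast hτ.ne'
  exact mul_ne_zero (mul_ne_zero (inv_ne_zero this) (Complex.exp_ne_zero _))
    (gammaProduct_ne_zero hτ hz)

/-! ### The functional equation -/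

/-- The sequence whose limit is `C(τ)`. -/
noncomputable def seqC (τ : ℝ) (N : ℕ) : ℝ :=
  (∑ k ∈ Finset.Ico 1 N, psi (k * τ)) + psi (N * τ) / 2
      - (1 / τ) * Real.log (Real.Gamma (N * τ) / Real.sqrt (2 * Real.pi))

/-- The sequence whose limit is `D(τ)`. -/
noncomputable def seqD (τ : ℝ) (N : ℕ) : ℝ :=
  (∑ k ∈ Finset.Ico 1 N, psi' (k * τ)) + psi' (N * τ) / 2 - (1 / τ) * psi (N * τ)

/-- Shifting `z` by `τ` moves the Gamma factors of the truncated product by one place. -/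
lemma inv_Gamma_mul_partialGammaProduct_add (τ : ℝ) (N : ℕ) (z : ℂ) :
    (Complex.Gamma z)⁻¹ * partialGammaProduct τ N (z + τ) =
      partialGammaProduct τ N z * (Complex.Gamma (z + ((N + 1 : ℕ) * τ : ℝ)))⁻¹ *
        Complex.exp (τ * (∑ k ∈ Finset.range N, psi ((k + 1 : ℕ) * τ) : ℝ) +
          (z * τ + τ ^ 2 / 2) * (∑ k ∈ Finset.range N, psi' ((k + 1 : ℕ) * τ) : ℝ)) := by
  induction N with
  | zero => simp [partialGammaProduct]
  | succ N ih =>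
    have e1 : partialGammaProduct τ (N + 1) (z + τ) =
        partialGammaProduct τ N (z + τ) * gammaFactor (z + τ) ((N + 1 : ℕ) * τ) := by
      simp only [partialGammaProduct, Finset.prod_range_succ, mul_assoc]
    have e2 : partialGammaProduct τ (N + 1) z =
        partialGammaProduct τ N z * gammaFactor z ((N + 1 : ℕ) * τ) := by
      simp only [partialGammaProduct, Finset.prod_range_succ, mul_assoc]
    -- the factor `1/Γ(z+τ+(N+1)τ)` on the left is the new boundary factor `1/Γ(z+(N+2)τ)`
    rw [e1, ← mul_assoc, ih, e2, gammaFactor, gammaFactor, Finset.sum_range_succ,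
      Finset.sum_range_succ]
    have e3 : z + τ + ((N + 1 : ℕ) * τ : ℝ) = z + ((N + 1 + 1 : ℕ) * τ : ℝ) := by
      push_cast
      ring
    rw [e3]
    set x : ℝ := (N + 1 : ℕ) * τ
    have e4 : ∀ s t : ℝ, Complex.exp (τ * ((s + psi x : ℝ) : ℂ) +
        (z * τ + τ ^ 2 / 2) * ((t + psi' x : ℝ) : ℂ)) *
          Complex.exp (z * (psi x : ℂ) + z ^ 2 / 2 * (psi' x : ℂ)) =
        Complex.exp (τ * (s : ℂ) + (z * τ + τ ^ 2 / 2) * (t : ℂ)) *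
          Complex.exp ((z + τ) * (psi x : ℂ) + (z + τ) ^ 2 / 2 * (psi' x : ℂ)) := fun s t => by
      rw [← Complex.exp_add, ← Complex.exp_add]
      congr 1
      push_cast
      ring
    have e5 := e4 (∑ k ∈ Finset.range N, psi ((k + 1 : ℕ) * τ))
      (∑ k ∈ Finset.range N, psi' ((k + 1 : ℕ) * τ))
    linear_combination (-(partialGammaProduct τ N z * (Complex.Gamma (z + x))⁻¹ * Complex.Gamma x *
      (Complex.Gamma (z + ((N + 1 + 1 : ℕ) * τ : ℝ)))⁻¹)) * e5

/-- The finite form of the functional equation: the error is a further factor of the product and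
a multiple of `ψ'(x)`, both negligible as `N → ∞`. -/
lemma inv_Gamma_mul_partialGammaProduct_add_eq {τ : ℝ} (hτ : 0 < τ) (N : ℕ) (z : ℂ) :
    (Complex.Gamma z)⁻¹ * partialGammaProduct τ N (z + τ) =
      partialGammaProduct τ N z * gammaFactor z ((N + 1 : ℕ) * τ) *
        Complex.exp (τ * (seqC τ (N + 1) : ℂ) + (z * τ + τ ^ 2 / 2) * (seqD τ (N + 1) : ℂ)
          - (Real.log (2 * Real.pi) / 2 : ℝ)
          - (z ^ 2 / 2 + (z * τ + τ ^ 2 / 2) / 2) * (psi' ((N + 1 : ℕ) * τ) : ℂ)) := by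
  have hsum : ∀ f : ℝ → ℝ, ∑ k ∈ Finset.Ico 1 (N + 1), f (k * τ) =
      ∑ k ∈ Finset.range N, f ((k + 1 : ℕ) * τ) := fun f => by
    rw [Finset.sum_Ico_eq_sum_range]
    simp [add_comm]
  rw [inv_Gamma_mul_partialGammaProduct_add, seqC, seqD, hsum, hsum, gammaFactor]
  have hx : 0 < ((N + 1 : ℕ) : ℝ) * τ := by positivity
  generalize ((N + 1 : ℕ) : ℝ) * τ = x at hx ⊢
  have hG := Real.Gamma_pos_of_pos hx
  have hπ : 0 < 2 * Real.pi := by positivity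
  have hΓ : Complex.Gamma x = Complex.exp (Real.log (Real.Gamma x) : ℝ) := by
    rw [← Complex.ofReal_exp, Real.exp_log hG, Complex.Gamma_ofReal]
  rw [Real.log_div hG.ne' (by positivity), Real.log_sqrt hπ.le, hΓ]
  have hτ' : (τ : ℂ) ≠ 0 := by exact_mod_cast hτ.ne'
  set A : ℝ := ∑ k ∈ Finset.range N, psi ((k + 1 : ℕ) * τ)
  set B : ℝ := ∑ k ∈ Finset.range N, psi' ((k + 1 : ℕ) * τ)
  -- `l` stands for `log Γ(x)`: the terms in `ψ(x)` and `log Γ(x)` cancel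
  have key : ∀ l : ℝ, Complex.exp (τ * (A : ℂ) + (z * τ + τ ^ 2 / 2) * (B : ℂ)) =
      Complex.exp (l : ℂ) * Complex.exp (z * (psi x : ℂ) + z ^ 2 / 2 * (psi' x : ℂ)) *
      Complex.exp (τ * ((A + psi x / 2 - 1 / τ * (l - Real.log (2 * Real.pi) / 2) : ℝ) : ℂ) +
        (z * τ + τ ^ 2 / 2) * ((B + psi' x / 2 - 1 / τ * psi x : ℝ) : ℂ)
          - (Real.log (2 * Real.pi) / 2 : ℝ)
          - (z ^ 2 / 2 + (z * τ + τ ^ 2 / 2) / 2) * (psi' x : ℂ)) := fun l => by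
    rw [← Complex.exp_add, ← Complex.exp_add]
    congr 1
    push_cast
    field_simp
    ring
  linear_combination (partialGammaProduct τ N z * (Complex.Gamma (z + x))⁻¹) *
    key (Real.log (Real.Gamma x))

lemma ne_neg_lattice_of_pos {τ : ℝ} (hτ : 0 < τ) {z : ℂ} (hz : 0 < z.re) (k l : ℕ) :
    z ≠ -(k * τ + l) := by
  intro h
  have h1 := congrArg Complex.re h
  have : (0 : ℝ) ≤ k * τ := by positivity
  have : (0 : ℝ) ≤ l := by positivity
  simp at h1
  linarith

/-- At points where neither `G(z)` nor `G(z+τ)` vanishes, convergence of the products forces the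
linear combination of the two sequences in the exponent to converge. -/
lemma exists_tendsto_seqC_add_seqD {τ : ℝ} (hτ : 0 < τ) {y : ℝ} (hy : 0 < y) :
    ∃ l : ℝ, Tendsto (fun N : ℕ => τ * seqC τ (N + 1) + (y * τ + τ ^ 2 / 2) * seqD τ (N + 1)) atTop
      (𝓝 l) := by
  have hy' : 0 < (y : ℂ).re := by simpa
  have hyτ : 0 < ((y : ℂ) + τ).re := by
    simp
    linarith
  have h1 := (tendsto_partialGammaProduct hτ ((y : ℂ) + τ)).const_mul (Complex.Gamma y)⁻¹
  have h2 := (tendsto_partialGammaProduct hτ y).mul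
    ((tendsto_gammaFactor y).comp (tendsto_succ_mul_atTop hτ))
  have n1 : (Complex.Gamma y)⁻¹ * gammaProduct τ (y + τ) ≠ 0 :=
    mul_ne_zero (inv_ne_zero (Complex.Gamma_ne_zero_of_re_pos hy'))
      (gammaProduct_ne_zero hτ (ne_neg_lattice_of_pos hτ hyτ))
  have n2 : gammaProduct τ y * 1 ≠ 0 :=
    mul_ne_zero (gammaProduct_ne_zero hτ (ne_neg_lattice_of_pos hτ hy')) one_ne_zero
  have h3 := (h1.div h2 n2).norm.log (norm_ne_zero_iff.2 (div_ne_zero n1 n2))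
  have h4 := (h3.add_const (Real.log (2 * Real.pi) / 2)).add
    ((tendsto_psi'_atTop.comp (tendsto_succ_mul_atTop hτ)).const_mul
      (y ^ 2 / 2 + (y * τ + τ ^ 2 / 2) / 2))
  refine ⟨_, h4.congr' ?_⟩
  filter_upwards [h2.eventually_ne n2] with N hN
  simp only [Pi.div_apply, Function.comp] at hN ⊢
  rw [inv_Gamma_mul_partialGammaProduct_add_eq hτ, mul_div_cancel_left₀ _ hN, Complex.norm_exp,
    Real.log_exp]
  have e : (τ * (seqC τ (N + 1) : ℂ) + (y * τ + τ ^ 2 / 2) * (seqD τ (N + 1) : ℂ)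
          - (Real.log (2 * Real.pi) / 2 : ℝ)
          - ((y : ℂ) ^ 2 / 2 + (y * τ + τ ^ 2 / 2) / 2) * (psi' ((N + 1 : ℕ) * τ) : ℂ)) =
      ((τ * seqC τ (N + 1) + (y * τ + τ ^ 2 / 2) * seqD τ (N + 1) - Real.log (2 * Real.pi) / 2
        - (y ^ 2 / 2 + (y * τ + τ ^ 2 / 2) / 2) * psi' ((N + 1 : ℕ) * τ) : ℝ) : ℂ) := by
    push_cast
    ring
  rw [e, Complex.ofReal_re]
  ring

/-- The two points `1` and `2` separate the coefficients of the two sequences. -/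
lemma exists_tendsto_seqD {τ : ℝ} (hτ : 0 < τ) : ∃ l : ℝ, Tendsto (seqD τ) atTop (𝓝 l) := by
  obtain ⟨l₁, h₁⟩ := exists_tendsto_seqC_add_seqD hτ one_pos
  obtain ⟨l₂, h₂⟩ := exists_tendsto_seqC_add_seqD hτ two_pos
  refine ⟨(l₂ - l₁) / τ, (tendsto_add_atTop_iff_nat 1).1 (((h₂.sub h₁).div_const τ).congr ?_)⟩
  intro N
  field_simp
  ring

lemma exists_tendsto_seqC {τ : ℝ} (hτ : 0 < τ) : ∃ l : ℝ, Tendsto (seqC τ) atTop (𝓝 l) := by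
  obtain ⟨l₁, h₁⟩ := exists_tendsto_seqC_add_seqD hτ one_pos
  obtain ⟨l₂, h₂⟩ := exists_tendsto_seqD hτ
  have h₃ := ((tendsto_add_atTop_iff_nat 1).2 h₂).const_mul (1 * τ + τ ^ 2 / 2)
  refine ⟨_, (tendsto_add_atTop_iff_nat 1).1 (((h₁.sub h₃).div_const τ).congr ?_)⟩
  intro N
  field_simp
  ring

lemma tendsto_seqC {τ : ℝ} (hτ : 0 < τ) : Tendsto (seqC τ) atTop (𝓝 (constC τ)) :=
  tendsto_nhds_limUnder (exists_tendsto_seqC hτ)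

lemma tendsto_seqD {τ : ℝ} (hτ : 0 < τ) : Tendsto (seqD τ) atTop (𝓝 (constD τ)) :=
  tendsto_nhds_limUnder (exists_tendsto_seqD hτ)

lemma inv_Gamma_mul_gammaProduct_add {τ : ℝ} (hτ : 0 < τ) (z : ℂ) :
    (Complex.Gamma z)⁻¹ * gammaProduct τ (z + τ) = gammaProduct τ z *
      Complex.exp (τ * (constC τ : ℂ) + (z * τ + τ ^ 2 / 2) * (constD τ : ℂ)
        - (Real.log (2 * Real.pi) / 2 : ℝ)) := by
  have hc := (Complex.continuous_ofReal.tendsto _).comp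
    ((tendsto_add_atTop_iff_nat 1).2 (tendsto_seqC hτ))
  have hd := (Complex.continuous_ofReal.tendsto _).comp
    ((tendsto_add_atTop_iff_nat 1).2 (tendsto_seqD hτ))
  have hp := (Complex.continuous_ofReal.tendsto _).comp
    (tendsto_psi'_atTop.comp (tendsto_succ_mul_atTop hτ))
  have h := ((tendsto_partialGammaProduct hτ z).mul
    ((tendsto_gammaFactor z).comp (tendsto_succ_mul_atTop hτ))).mul
    ((((hc.const_mul (τ : ℂ)).add (hd.const_mul (z * τ + τ ^ 2 / 2))).sub_const
      ((Real.log (2 * Real.pi) / 2 : ℝ) : ℂ)).sub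
        (hp.const_mul (z ^ 2 / 2 + (z * τ + τ ^ 2 / 2) / 2))).cexp
  rw [Complex.ofReal_zero, mul_zero, sub_zero, mul_one] at h
  refine tendsto_nhds_unique ((tendsto_partialGammaProduct hτ (z + τ)).const_mul _) (h.congr ?_)
  exact fun N => (inv_Gamma_mul_partialGammaProduct_add_eq hτ N z).symm

/-- The multiplier `(2π)^{(τ-1)/2} τ^{1/2-z}` of the functional equation
`G(z+τ) = (2π)^{(τ-1)/2} τ^{1/2-z} Γ(z) G(z)`. -/
noncomputable def shiftFactor (τ : ℝ) (z : ℂ) : ℂ :=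
  Complex.exp ((Real.log (2 * Real.pi) : ℝ) * ((τ - 1) / 2) + (Real.log τ : ℝ) * (1 / 2 - z))

/-- The functional equation `G(z+τ) = (2π)^{(τ-1)/2} τ^{1/2-z} Γ(z) G(z)`. Dividing by `Γ(z)`
makes it hold at the poles of `Γ` too, where Mathlib's `Γ` is `0` and both sides vanish. -/
lemma inv_Gamma_mul_doubleGamma_add {τ : ℝ} (hτ : 0 < τ) (z : ℂ) :
    (Complex.Gamma z)⁻¹ * doubleGamma (z + τ) τ = shiftFactor τ z * doubleGamma z τ := by
  have hτ' : (τ : ℂ) ≠ 0 := by exact_mod_cast hτ.ne'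
  rw [doubleGamma_eq, doubleGamma_eq, mul_left_comm, inv_Gamma_mul_gammaProduct_add hτ,
    shiftFactor, constA, constB, Real.log_mul (by positivity) hτ.ne']
  have e : Complex.exp (((τ / 2 * (Real.log (2 * Real.pi) + Real.log τ) + 1 / 2 * Real.log τ
        - τ * constC τ : ℝ) : ℂ) * (z + τ) / τ
        + ((-(τ * Real.log τ) - τ ^ 2 * constD τ : ℝ) : ℂ) * (z + τ) ^ 2 / (2 * (τ : ℂ) ^ 2)) *
      Complex.exp (τ * (constC τ : ℂ) + (z * τ + τ ^ 2 / 2) * (constD τ : ℂ)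
        - (Real.log (2 * Real.pi) / 2 : ℝ)) =
      Complex.exp ((Real.log (2 * Real.pi) : ℝ) * ((τ - 1) / 2)
        + (Real.log τ : ℝ) * (1 / 2 - z)) *
      Complex.exp (((τ / 2 * (Real.log (2 * Real.pi) + Real.log τ) + 1 / 2 * Real.log τ
        - τ * constC τ : ℝ) : ℂ) * z / τ
        + ((-(τ * Real.log τ) - τ ^ 2 * constD τ : ℝ) : ℂ) * z ^ 2 / (2 * (τ : ℂ) ^ 2)) := by
    rw [← Complex.exp_add, ← Complex.exp_add]
    congr 1
    generalize Real.log (2 * Real.pi) = p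
    generalize Real.log τ = t
    push_cast
    field_simp
    ring
  linear_combination ((τ : ℂ)⁻¹ * gammaProduct τ z) * e

lemma shiftFactor_ne_zero (τ : ℝ) (z : ℂ) : shiftFactor τ z ≠ 0 := Complex.exp_ne_zero _

lemma doubleGamma_add_div {τ : ℝ} (hτ : 0 < τ) {z : ℂ} (hz : ∀ k l : ℕ, z ≠ -(k * τ + l)) :
    doubleGamma (z + τ) τ / doubleGamma z τ = shiftFactor τ z * Complex.Gamma z := by
  have hΓ : Complex.Gamma z ≠ 0 := Complex.Gamma_ne_zero fun l => by simpa using hz 0 l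
  rw [div_eq_iff (doubleGamma_ne_zero hτ hz)]
  have h := inv_Gamma_mul_doubleGamma_add hτ z
  field_simp at h
  rw [h]
  ring

/-- The right-hand side is `0`, as it must be, where `z - τ` is a pole of `Γ`. -/
lemma doubleGamma_sub_div {τ : ℝ} (hτ : 0 < τ) {z : ℂ} (hz : ∀ k l : ℕ, z ≠ -(k * τ + l)) :
    doubleGamma (z - τ) τ / doubleGamma z τ =
      (shiftFactor τ (z - τ))⁻¹ * (Complex.Gamma (z - τ))⁻¹ := by
  rw [div_eq_iff (doubleGamma_ne_zero hτ hz)]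
  have h := inv_Gamma_mul_doubleGamma_add hτ (z - τ)
  rw [sub_add_cancel] at h
  rw [mul_assoc, h, inv_mul_cancel_left₀ (shiftFactor_ne_zero _ _)]

/-! ### Contours and kernels -/

lemma IsSeparatingContour.mono {κ : ContourType} {γ : ℝ → ℂ} {L R L' R' : Set ℂ}
    (h : IsSeparatingContour κ γ L R) (hL : L' ⊆ L) (hR : R' ⊆ R) :
    IsSeparatingContour κ γ L' R' := by
  obtain ⟨h1, h2, h3⟩ := h
  refine ⟨h1, h2, ?_⟩
  cases κ <;> exact ⟨fun w hw => h3.1 w (hL hw), fun w hw => h3.2 w (hR hw)⟩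

lemma IsSeparatingContour.apply_notMem {κ : ContourType} {γ : ℝ → ℂ} {L R : Set ℂ}
    (h : IsSeparatingContour κ γ L R) (t : ℝ) : γ t ∉ L ∧ γ t ∉ R := by
  obtain ⟨-, -, h3⟩ := h
  cases κ <;> exact ⟨fun hw => (h3.1 _ hw).1 t rfl, fun hw => (h3.2 _ hw).1 t rfl⟩

lemma prod_Icc_add {M : Type*} [CommMonoid M] (f : ℕ → M) (c d : ℕ) :
    ∏ i ∈ Finset.Icc (c + 1) (c + d), f i = ∏ i ∈ Finset.Icc 1 d, f (c + i) := by
  rw [← Finset.map_add_left_Icc 1 d c, Finset.prod_map]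
  rfl

lemma prod_Icc_one_add {M : Type*} [CommMonoid M] (f : ℕ → M) (c d : ℕ) :
    ∏ i ∈ Finset.Icc 1 (c + d), f i =
      (∏ i ∈ Finset.Icc 1 c, f i) * ∏ i ∈ Finset.Icc 1 d, f (c + i) := by
  induction d with
  | zero => simp
  | succ d ih =>
    rw [← add_assoc, Finset.prod_Icc_succ_top (by omega), ih, Finset.prod_Icc_succ_top (by omega),
      mul_assoc, add_assoc]

lemma sum_Icc_one_add {M : Type*} [AddCommMonoid M] (f : ℕ → M) (c d : ℕ) :
    ∑ i ∈ Finset.Icc 1 (c + d), f i =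
      (∑ i ∈ Finset.Icc 1 c, f i) + ∑ i ∈ Finset.Icc 1 d, f (c + i) :=
  prod_Icc_one_add (M := Multiplicative M) f c d

lemma prod_shiftFactor (τ : ℝ) (N : ℕ) (w : ℕ → ℂ) :
    ∏ i ∈ Finset.Icc 1 N, shiftFactor τ (w i) =
      Complex.exp (N * ((Real.log (2 * Real.pi) : ℝ) * ((τ - 1) / 2))
        + (Real.log τ : ℝ) * (N / 2 - ∑ i ∈ Finset.Icc 1 N, w i)) := by
  simp only [shiftFactor]
  rw [← Complex.exp_sum, Finset.sum_add_distrib, ← Finset.mul_sum _ _ (Real.log τ : ℂ),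
    Finset.sum_sub_distrib]
  simp [div_eq_mul_inv]

/-- The double gamma quotients pair off; each pair is given, by the functional equation, by a gamma
function or its reciprocal and a `shiftFactor`. -/
lemma kernelI_eq_kernelH (m₀ n₀ d e : ℕ) (τ : ℝ) (a b a' b' : ℕ → ℂ) (α β α' β' : ℕ → ℝ) (s : ℂ)
    (h₁ : ∀ i ∈ Finset.Icc 1 m₀, doubleGamma (b i + β i * s) τ /
        doubleGamma (a (n₀ + e + i) + α (n₀ + e + i) * s) τ =
      shiftFactor τ (b' i + β' i * s) * Complex.Gamma (b' i + β' i * s))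
    (h₂ : ∀ i ∈ Finset.Icc 1 d, doubleGamma (b (m₀ + i) + β (m₀ + i) * s) τ /
        doubleGamma (a (n₀ + e + (m₀ + i)) + α (n₀ + e + (m₀ + i)) * s) τ =
      (shiftFactor τ (a' (n₀ + i) + α' (n₀ + i) * s))⁻¹ *
        (Complex.Gamma (a' (n₀ + i) + α' (n₀ + i) * s))⁻¹)
    (h₃ : ∀ i ∈ Finset.Icc 1 n₀, doubleGamma (1 + τ - a i - α i * s) τ /
        doubleGamma (1 + τ - b (m₀ + d + i) - β (m₀ + d + i) * s) τ =
      shiftFactor τ (1 - a' i - α' i * s) * Complex.Gamma (1 - a' i - α' i * s))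
    (h₄ : ∀ i ∈ Finset.Icc 1 e, doubleGamma (1 + τ - a (n₀ + i) - α (n₀ + i) * s) τ /
        doubleGamma (1 + τ - b (m₀ + d + (n₀ + i)) - β (m₀ + d + (n₀ + i)) * s) τ =
      (shiftFactor τ (1 - b' (m₀ + i) - β' (m₀ + i) * s))⁻¹ *
        (Complex.Gamma (1 - b' (m₀ + i) - β' (m₀ + i) * s))⁻¹) :
    kernelI (m₀ + d) (n₀ + e) (m₀ + d + (n₀ + e)) (m₀ + d + (n₀ + e)) a α b β τ s =
      Complex.exp (((m₀ : ℂ) + n₀ - d - e) * ((Real.log (2 * Real.pi) : ℝ) * ((τ - 1) / 2))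
        + (Real.log τ : ℝ) * (((m₀ : ℂ) + e - n₀ - d) / 2
          - (∑ k ∈ Finset.Icc 1 (m₀ + e), b' k - ∑ k ∈ Finset.Icc 1 (n₀ + d), a' k)
          - ((∑ k ∈ Finset.Icc 1 (m₀ + e), β' k - ∑ k ∈ Finset.Icc 1 (n₀ + d), α' k : ℝ) : ℂ) * s))
      * kernelH m₀ n₀ (n₀ + d) (m₀ + e) a' α' b' β' s := by
  have E : (∏ i ∈ Finset.Icc 1 m₀, shiftFactor τ (b' i + β' i * s)) *
      (∏ i ∈ Finset.Icc 1 d, shiftFactor τ (a' (n₀ + i) + α' (n₀ + i) * s))⁻¹ *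
      (∏ i ∈ Finset.Icc 1 n₀, shiftFactor τ (1 - a' i - α' i * s)) *
      (∏ i ∈ Finset.Icc 1 e, shiftFactor τ (1 - b' (m₀ + i) - β' (m₀ + i) * s))⁻¹ =
      Complex.exp (((m₀ : ℂ) + n₀ - d - e) * ((Real.log (2 * Real.pi) : ℝ) * ((τ - 1) / 2))
        + (Real.log τ : ℝ) * (((m₀ : ℂ) + e - n₀ - d) / 2
          - (∑ k ∈ Finset.Icc 1 (m₀ + e), b' k - ∑ k ∈ Finset.Icc 1 (n₀ + d), a' k)
          - ((∑ k ∈ Finset.Icc 1 (m₀ + e), β' k - ∑ k ∈ Finset.Icc 1 (n₀ + d), α' k : ℝ) : ℂ)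
            * s)) := by
    rw [prod_shiftFactor, prod_shiftFactor, prod_shiftFactor, prod_shiftFactor, ← Complex.exp_neg,
      ← Complex.exp_neg, ← Complex.exp_add, ← Complex.exp_add, ← Complex.exp_add]
    congr 1
    simp only [sum_Icc_one_add, Finset.sum_add_distrib, Finset.sum_sub_distrib, ← Finset.sum_mul,
      Finset.sum_const, Nat.card_Icc, Complex.ofReal_sub, Complex.ofReal_add, Complex.ofReal_sum,
      nsmul_eq_mul, add_tsub_cancel_right, mul_one]
    ring
  rw [← E]
  have hI : kernelI (m₀ + d) (n₀ + e) (m₀ + d + (n₀ + e)) (m₀ + d + (n₀ + e)) a α b β τ s =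
      (∏ i ∈ Finset.Icc 1 (m₀ + d), doubleGamma (b i + β i * s) τ /
        doubleGamma (a (n₀ + e + i) + α (n₀ + e + i) * s) τ) *
      ∏ i ∈ Finset.Icc 1 (n₀ + e), doubleGamma (1 + τ - a i - α i * s) τ /
        doubleGamma (1 + τ - b (m₀ + d + i) - β (m₀ + d + i) * s) τ := by
    rw [Finset.prod_div_distrib, Finset.prod_div_distrib, kernelI, prod_Icc_add,
      add_comm (m₀ + d) (n₀ + e), prod_Icc_add, div_mul_div_comm]
    congr 1
    ring
  rw [hI, prod_Icc_one_add, prod_Icc_one_add, Finset.prod_congr rfl h₁, Finset.prod_congr rfl h₂,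
    Finset.prod_congr rfl h₃, Finset.prod_congr rfl h₄, kernelH, prod_Icc_add, prod_Icc_add]
  simp only [Finset.prod_mul_distrib, Finset.prod_inv_distrib]
  rw [div_eq_mul_inv, mul_inv]
  ring

lemma ofReal_rpow_mul_cpow {τ : ℝ} (hτ : 0 < τ) (Δ : ℝ) {z : ℂ} (hz : z ≠ 0) (s : ℂ) :
    (((τ ^ Δ : ℝ) : ℂ) * z) ^ (-s) = Complex.exp (-((Real.log τ : ℝ) * (Δ * s))) * z ^ (-s) := by
  have h : ((τ ^ Δ : ℝ) : ℂ) ≠ 0 := by exact_mod_cast (Real.rpow_pos_of_pos hτ Δ).ne'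
  rw [Complex.cpow_def_of_ne_zero (mul_ne_zero h hz), Complex.cpow_def_of_ne_zero hz,
    Complex.log_ofReal_mul (Real.rpow_pos_of_pos hτ Δ) hz, Real.log_rpow hτ, ← Complex.exp_add]
  congr 1
  push_cast
  ring

lemma contourIntegrable_iff_of_eq_mul {f g : ℂ → ℂ} {γ : ℝ → ℂ} {K : ℂ} (hK : K ≠ 0)
    (h : ∀ t, f (γ t) = K * g (γ t)) : ContourIntegrable f γ ↔ ContourIntegrable g γ := by
  simp only [ContourIntegrable, h, mul_assoc]
  exact MeasureTheory.integrable_const_mul_iff hK.isUnit _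

lemma contourIntegral_of_eq_mul {f g : ℂ → ℂ} {γ : ℝ → ℂ} {K : ℂ}
    (h : ∀ t, f (γ t) = K * g (γ t)) : contourIntegral f γ = K * contourIntegral g γ := by
  simp only [contourIntegral, h, mul_assoc]
  exact MeasureTheory.integral_const_mul _ _

/-- A point off the poles `leftPolesI` is not a zero of the corresponding double gamma factor. -/
lemma ne_neg_lattice_of_notMem_leftPolesI {n p : ℕ} {a : ℕ → ℂ} {α : ℕ → ℝ} {τ : ℝ} {s : ℂ}
    (hs : s ∉ leftPolesI n p a α τ) {j : ℕ} (hj : j ∈ Finset.Icc (n + 1) p) (hα : 0 < α j)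
    (k l : ℕ) : a j + α j * s ≠ -(k * τ + l) := by
  intro h
  refine hs ⟨j, hj, k, l, ?_⟩
  have : (α j : ℂ) ≠ 0 := by exact_mod_cast hα.ne'
  field_simp
  linear_combination h

/-- A point off the poles `rightPolesI` is not a zero of the corresponding double gamma factor. -/
lemma ne_neg_lattice_of_notMem_rightPolesI {m q : ℕ} {b : ℕ → ℂ} {β : ℕ → ℝ} {τ : ℝ} {s : ℂ}
    (hs : s ∉ rightPolesI m q b β τ) {i : ℕ} (hi : i ∈ Finset.Icc (m + 1) q) (hβ : 0 < β i)
    (k l : ℕ) : 1 + τ - b i - β i * s ≠ -(k * τ + l) := by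
  intro h
  refine hs ⟨i, hi, k + 1, l + 1, by omega, by omega, ?_⟩
  have : (β i : ℂ) ≠ 0 := by exact_mod_cast hβ.ne'
  field_simp
  push_cast
  linear_combination -h

end FoxBarnes

theorem mainTheorem2 (m n p q m₀ n₀ : ℕ) (τ : ℝ) (a b : ℕ → ℂ) (α β : ℕ → ℝ)
    (hτ : 0 < τ)
    (hα : ∀ i ∈ Finset.Icc 1 p, 0 < α i) (hβ : ∀ i ∈ Finset.Icc 1 q, 0 < β i)
    (hp : p = m + n) (hq : q = m + n)
    (hαβ : ∀ i ∈ Finset.Icc 1 n, α i = β (m + i))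
    (hβα : ∀ i ∈ Finset.Icc 1 m, β i = α (n + i))
    (hm₀ : 1 ≤ m₀ ∧ m₀ ≤ m) (hn₀ : 1 ≤ n₀ ∧ n₀ ≤ n)
    (ha₁ : ∀ i ∈ Finset.Icc 1 n₀, a i = b (m + i) - τ)
    (ha₂ : ∀ i ∈ Finset.Icc (n₀ + 1) n, a i = b (m + i) + τ)
    (hb₁ : ∀ i ∈ Finset.Icc 1 m₀, b i = a (n + i) + τ)
    (hb₂ : ∀ i ∈ Finset.Icc (m₀ + 1) m, b i = a (n + i) - τ)
    (z : ℂ) (hz : z ≠ 0)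
    (κ : FoxBarnes.ContourType) (γ : ℝ → ℂ)
    (hγ : FoxBarnes.IsContourI m n p q a α b β τ κ γ) :
    let p₀ : ℕ := n₀ + m - m₀
    let q₀ : ℕ := m₀ + n - n₀
    let N₀ : ℝ := 2 * (m₀ + n₀) - (p₀ + q₀)
    let ν₀ : ℝ := ((q₀ : ℝ) - p₀) / 2
    let a' : ℕ → ℂ := fun k => if k ≤ n₀ then a k else a (n - n₀ + m₀ + k) - τ
    let b' : ℕ → ℂ := fun k => if k ≤ m₀ then b k - τ else b (m - m₀ + n₀ + k)
    let α' : ℕ → ℝ := fun k => if k ≤ n₀ then α k else α (n - n₀ + m₀ + k)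
    let β' : ℕ → ℝ := fun k => if k ≤ m₀ then β k else β (m - m₀ + n₀ + k)
    let Δ' : ℝ := ∑ k ∈ Finset.Icc 1 q₀, β' k - ∑ k ∈ Finset.Icc 1 p₀, α' k
    let δ' : ℂ := ∑ k ∈ Finset.Icc 1 q₀, b' k - ∑ k ∈ Finset.Icc 1 p₀, a' k
    FoxBarnes.IsContourH m₀ n₀ a' α' b' β' κ γ ∧
    (FoxBarnes.ContourIntegrable (FoxBarnes.integrandI m n p q a α b β τ 0 z) γ ↔
      FoxBarnes.ContourIntegrable
        (FoxBarnes.integrandH m₀ n₀ p₀ q₀ a' α' b' β' (((τ ^ Δ' : ℝ) : ℂ) * z)) γ) ∧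
    FoxBarnes.foxBarnesI m n p q a α b β τ 0 z γ =
      (((2 * Real.pi) ^ ((τ - 1) * N₀ / 2) : ℝ) : ℂ) * (τ : ℂ) ^ ((ν₀ : ℂ) - δ') *
        FoxBarnes.foxH m₀ n₀ p₀ q₀ a' α' b' β' (((τ ^ Δ' : ℝ) : ℂ) * z) γ := by
  intro p₀ q₀ N₀ ν₀ a' b' α' β' Δ' δ'
  obtain ⟨d, rfl⟩ := Nat.exists_eq_add_of_le hm₀.2
  obtain ⟨e, rfl⟩ := Nat.exists_eq_add_of_le hn₀.2
  subst hp hq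
  have hp₀ : p₀ = n₀ + d := by omega
  have hq₀ : q₀ = m₀ + e := by omega
  have ea : ∀ i ∈ Finset.Icc 1 n₀, a' i = a i := fun i hi => if_pos (Finset.mem_Icc.1 hi).2
  have eα : ∀ i ∈ Finset.Icc 1 n₀, α' i = α i := fun i hi => if_pos (Finset.mem_Icc.1 hi).2
  have eb : ∀ i ∈ Finset.Icc 1 m₀, b' i = b i - τ := fun i hi => if_pos (Finset.mem_Icc.1 hi).2
  have eβ : ∀ i ∈ Finset.Icc 1 m₀, β' i = β i := fun i hi => if_pos (Finset.mem_Icc.1 hi).2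
  have ia : ∀ i, n₀ + e - n₀ + m₀ + (n₀ + i) = n₀ + e + (m₀ + i) := fun i => by omega
  have ib : ∀ i, m₀ + d - m₀ + n₀ + (m₀ + i) = m₀ + d + (n₀ + i) := fun i => by omega
  have ea' : ∀ i ∈ Finset.Icc 1 d, a' (n₀ + i) = a (n₀ + e + (m₀ + i)) - τ := fun i hi => by
    have := Finset.mem_Icc.1 hi
    simp only [a', ia, if_neg (show ¬ n₀ + i ≤ n₀ by omega)]
  have eα' : ∀ i ∈ Finset.Icc 1 d, α' (n₀ + i) = α (n₀ + e + (m₀ + i)) := fun i hi => by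
    have := Finset.mem_Icc.1 hi
    simp only [α', ia, if_neg (show ¬ n₀ + i ≤ n₀ by omega)]
  have eb' : ∀ i ∈ Finset.Icc 1 e, b' (m₀ + i) = b (m₀ + d + (n₀ + i)) := fun i hi => by
    have := Finset.mem_Icc.1 hi
    simp only [b', ib, if_neg (show ¬ m₀ + i ≤ m₀ by omega)]
  have eβ' : ∀ i ∈ Finset.Icc 1 e, β' (m₀ + i) = β (m₀ + d + (n₀ + i)) := fun i hi => by
    have := Finset.mem_Icc.1 hi
    simp only [β', ib, if_neg (show ¬ m₀ + i ≤ m₀ by omega)]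
  have hIH : FoxBarnes.IsContourH m₀ n₀ a' α' b' β' κ γ := by
    refine hγ.mono ?_ ?_
    · rintro s ⟨i, hi, k, rfl⟩
      have := Finset.mem_Icc.1 hi
      refine ⟨n₀ + e + i, Finset.mem_Icc.2 (by omega), 0, k, ?_⟩
      rw [eb i hi, eβ i hi, hb₁ i hi, hβα i (Finset.mem_Icc.2 (by omega))]
      push_cast
      ring
    · rintro s ⟨i, hi, k, rfl⟩
      have := Finset.mem_Icc.1 hi
      refine ⟨m₀ + d + i, Finset.mem_Icc.2 (by omega), 1, k + 1, le_rfl, by omega, ?_⟩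
      rw [ea i hi, eα i hi, ha₁ i hi, hαβ i (Finset.mem_Icc.2 (by omega))]
      push_cast
      ring
  set K : ℂ := (((2 * Real.pi) ^ ((τ - 1) * N₀ / 2) : ℝ) : ℂ) * (τ : ℂ) ^ ((ν₀ : ℂ) - δ') with hK
  have hτ' : (τ : ℂ) ≠ 0 := by exact_mod_cast hτ.ne'
  have hK_exp : K = Complex.exp (((m₀ : ℂ) + n₀ - d - e) *
      ((Real.log (2 * Real.pi) : ℝ) * ((τ - 1) / 2))
        + (Real.log τ : ℝ) * (((m₀ : ℂ) + e - n₀ - d) / 2 - δ')) := by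
    rw [hK, Real.rpow_def_of_pos (by positivity), Complex.cpow_def_of_ne_zero hτ',
      Complex.ofReal_exp, ← Complex.exp_add, ← Complex.ofReal_log hτ.le]
    congr 1
    simp only [N₀, ν₀, hp₀, hq₀]
    push_cast
    ring
  have hK0 : K ≠ 0 := hK_exp ▸ Complex.exp_ne_zero _
  have hpt : ∀ t, FoxBarnes.integrandI (m₀ + d) (n₀ + e) (m₀ + d + (n₀ + e)) (m₀ + d + (n₀ + e))
      a α b β τ 0 z (γ t) =
      K * FoxBarnes.integrandH m₀ n₀ p₀ q₀ a' α' b' β' (((τ ^ Δ' : ℝ) : ℂ) * z) (γ t) := by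
    intro t
    obtain ⟨hL, hR⟩ := hγ.apply_notMem t
    generalize γ t = s at hL hR ⊢
    have hl : ∀ i, 1 ≤ i → i ≤ m₀ + d → ∀ k l : ℕ,
        a (n₀ + e + i) + α (n₀ + e + i) * s ≠ -(k * τ + l) := fun i h1 h2 =>
      FoxBarnes.ne_neg_lattice_of_notMem_leftPolesI hL (Finset.mem_Icc.2 (by omega))
        (hα _ (Finset.mem_Icc.2 (by omega)))
    have hr : ∀ i, 1 ≤ i → i ≤ n₀ + e → ∀ k l : ℕ,
        1 + τ - b (m₀ + d + i) - β (m₀ + d + i) * s ≠ -(k * τ + l) := fun i h1 h2 =>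
      FoxBarnes.ne_neg_lattice_of_notMem_rightPolesI hR (Finset.mem_Icc.2 (by omega))
        (hβ _ (Finset.mem_Icc.2 (by omega)))
    have hker := FoxBarnes.kernelI_eq_kernelH m₀ n₀ d e τ a b a' b' α β α' β' s ?_ ?_ ?_ ?_
    · rw [FoxBarnes.integrandI, FoxBarnes.integrandH, hker,
        FoxBarnes.ofReal_rpow_mul_cpow hτ _ hz, hK_exp]
      simp only [Δ', δ', hp₀, hq₀, mul_zero, zero_mul, zero_div, Complex.exp_zero, mul_one]
      rw [mul_left_comm (FoxBarnes.kernelH _ _ _ _ _ _ _ _ _),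
        ← mul_assoc (Complex.exp _) (Complex.exp _), ← Complex.exp_add, mul_assoc]
      congr 2
      ring
    · intro i hi
      have := Finset.mem_Icc.1 hi
      rw [eb i hi, eβ i hi, hb₁ i hi, hβα i (Finset.mem_Icc.2 (by omega)), add_sub_cancel_right,
        ← FoxBarnes.doubleGamma_add_div hτ (hl i (by omega) (by omega)), add_right_comm]
    · intro i hi
      have := Finset.mem_Icc.1 hi
      rw [ea' i hi, eα' i hi, hb₂ _ (Finset.mem_Icc.2 (by omega)),
        hβα _ (Finset.mem_Icc.2 (by omega)), sub_add_eq_add_sub,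
        FoxBarnes.doubleGamma_sub_div hτ (hl (m₀ + i) (by omega) (by omega))]
    · intro i hi
      have := Finset.mem_Icc.1 hi
      have h := FoxBarnes.doubleGamma_add_div hτ (hr i (by omega) (by omega))
      have e1 : (1 : ℂ) + τ - b (m₀ + d + i) = 1 - (b (m₀ + d + i) - τ) := by ring
      have e2 : (1 : ℂ) + τ - (b (m₀ + d + i) - τ) - β (m₀ + d + i) * s =
        1 + τ - b (m₀ + d + i) - β (m₀ + d + i) * s + τ := by ring
      rw [ea i hi, eα i hi, ha₁ i hi, hαβ i (Finset.mem_Icc.2 (by omega)), e2, h, e1]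
    · intro i hi
      have := Finset.mem_Icc.1 hi
      have h := FoxBarnes.doubleGamma_sub_div hτ (hr (n₀ + i) (by omega) (by omega))
      have e1 : (1 : ℂ) + τ - b (m₀ + d + (n₀ + i)) - β (m₀ + d + (n₀ + i)) * s - τ =
        1 - b (m₀ + d + (n₀ + i)) - β (m₀ + d + (n₀ + i)) * s := by ring
      have e2 : (1 : ℂ) + τ - (b (m₀ + d + (n₀ + i)) + τ) - β (m₀ + d + (n₀ + i)) * s =
        1 + τ - b (m₀ + d + (n₀ + i)) - β (m₀ + d + (n₀ + i)) * s - τ := by ring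
      rw [eb' i hi, eβ' i hi, ha₂ _ (Finset.mem_Icc.2 (by omega)),
        hαβ _ (Finset.mem_Icc.2 (by omega)), e2, h, e1]
  refine ⟨hIH, FoxBarnes.contourIntegrable_iff_of_eq_mul hK0 hpt, ?_⟩
  rw [FoxBarnes.foxBarnesI, FoxBarnes.foxH, FoxBarnes.contourIntegral_of_eq_mul hpt]
  ring
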